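/- Let $n\ge 2$ and let $K\subset\mathbb{R}^n$ be a compact convex body with the origin in its interior. Let $L$ be its Minkowski functional, i.e. $L(\mathbf 0)=0$ and, for $v\neq\mathbf 0$, $L(v)>0$ is the unique positive number with $v/L(v)\in\partial K$. Assume that $L$ is a Finsler–Minkowski functional: near every nonzero vector, $L$ is of class $C^4$ and the Hessian matrix of $\tfrac12L^2$ is positive definite. For $p$ in the interior $U$ of $K$ let $L_p$ be the Minkowski functional of $K_p=K-p$, so that $L\big(p+v/L_p(v)\big)=1$ for $v\ne\mathbf 0$ ($U$ with $F(v_p)=L_p(v)$ is the associated Funk space). Put $g^{p}_{ij}=\frac{\partial^2}{\partial y^j\partial y^i}\big(\tfrac12L_p^2\big)$ and let $$\mu_p=\sqrt{\det g^{p}_{ij}}\;\sum_{i=1}^n(-1)^{i-1}y^i\,dy^1\wedge\dots\wedge dy^{i-1}\wedge dy^{i+1}\wedge\dots\wedge dy^n$$ be the induced volume form on the indicatrix hypersurface $\partial K_p=L_p^{-1}(1)$, oriented by its outward normal; write $\mu=\mu_{\mathbf 0}$. The area function is $$r\colon U\to\mathbb{R},\qquad r(p)=\int_{\partial K_p}1\,\mu_p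 .$$ The body $K$ is called balanced if the linear functional $\beta(v)=\int_{\partial K}\Big(\sum_{i=1}^n v^i\frac{\partial L}{\partial y^i}\Big)\mu$ is identically zero. Then $K$ is balanced if and only if $r$ attains its global minimum over $U$ at the origin, i.e. $r(\mathbf 0)\le r(p)$ for all $p\in U$. -/

import Mathlib

open MeasureTheory

noncomputable section

/-- The energy function `E = (1/2) L ^ 2` of a functional `L` on `ℝⁿ`. -/
def energy {n : ℕ} (L : EuclideanSpace ℝ (Fin n) → ℝ) (y : EuclideanSpace ℝ (Fin n)) : ℝ :=
  (1 / 2) * L y ^ 2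

/-- The Riemann-Finsler metric `g_ij = ∂²E / ∂y^j ∂y^i` at `y`: the Hessian matrix, in the standard
coordinates, of the energy function of `L`. -/
def finslerMetric {n : ℕ} (L : EuclideanSpace ℝ (Fin n) → ℝ) (y : EuclideanSpace ℝ (Fin n)) :
    Matrix (Fin n) (Fin n) ℝ :=
  Matrix.of fun i j =>
    fderiv ℝ (fun z => fderiv ℝ (energy L) z (EuclideanSpace.single i (1 : ℝ))) y
      (EuclideanSpace.single j (1 : ℝ))

/-- `L` is of class `C⁴` near each nonzero vector, where the Hessian matrix of its energy function
is positive definite. It is applied below to the Minkowski functional `gauge K` of a convex body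
`K` with the origin in its interior. -/
def IsFinslerMinkowski {n : ℕ} (L : EuclideanSpace ℝ (Fin n) → ℝ) : Prop :=
  ∀ v : EuclideanSpace ℝ (Fin n), v ≠ 0 → ContDiffAt ℝ 4 L v ∧ (finslerMetric L v).PosDef

/-- The indicatrix hypersurface `L⁻¹(1)`. When `L = gauge K`, this is the boundary of `K`. -/
def indicatrix {n : ℕ} (L : EuclideanSpace ℝ (Fin n) → ℝ) : Set (EuclideanSpace ℝ (Fin n)) :=
  {y | L y = 1}

/-- The Euclidean outward unit normal of the indicatrix hypersurface at `y`. -/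
def outerNormal {n : ℕ} (L : EuclideanSpace ℝ (Fin n) → ℝ) (y : EuclideanSpace ℝ (Fin n)) :
    EuclideanSpace ℝ (Fin n) :=
  ‖gradient L y‖⁻¹ • gradient L y

/-- The density, with respect to the Euclidean surface area `dA` of the indicatrix hypersurface, of
the volume form `μ = √(det g) ∑ (-1)^(i-1) y^i dy^1 ∧ … (omit dy^i) … ∧ dy^n` that the metric `g`
induces on it, the interior product of the Riemannian volume form `√(det g) dy^1 ∧ … ∧ dy^n` with
the field `C(y) = y`, which is the outward `g`-unit normal. The restriction of
`∑ (-1)^(i-1) y^i dy^1 ∧ … (omit dy^i) … ∧ dy^n` to a hypersurface with Euclidean unit normal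
`ν` is `⟪y, ν⟫ dA`. -/
def indicatrixDensity {n : ℕ} (L : EuclideanSpace ℝ (Fin n) → ℝ)
    (y : EuclideanSpace ℝ (Fin n)) : ℝ :=
  Real.sqrt (finslerMetric L y).det * inner ℝ y (outerNormal L y)

/-- The integral `∫ f μ` over the indicatrix hypersurface of `L`. The Euclidean surface area is the
`(n - 1)`-dimensional Hausdorff measure, in the Euclidean normalization. -/
def indicatrixIntegral {n : ℕ} (L : EuclideanSpace ℝ (Fin n) → ℝ)
    (f : EuclideanSpace ℝ (Fin n) → ℝ) : ℝ :=
  ∫ y in indicatrix L, f y * indicatrixDensity L y ∂μHE[n - 1]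

/-- The associated linear functional `β(v) = ∫ (VL) μ`, where `VL = v^i ∂L/∂y^i`. -/
def associatedForm {n : ℕ} (L : EuclideanSpace ℝ (Fin n) → ℝ)
    (v : EuclideanSpace ℝ (Fin n)) : ℝ :=
  indicatrixIntegral L fun y => fderiv ℝ L y v

/-- The body `K` is balanced if the linear functional `β` of its Minkowski functional vanishes. -/
def IsBalancedBody {n : ℕ} (K : Set (EuclideanSpace ℝ (Fin n))) : Prop :=
  ∀ v : EuclideanSpace ℝ (Fin n), associatedForm (gauge K) v = 0

/-- The fundamental function `F(v_p) = L_p(v)` of the Funk space of `K`: the Minkowski functional of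
the body `K` seen from the base point `p`, so that `p + v / L_p(v)` lies on the boundary of `K`
for `p` in the interior of `K` and `v ≠ 0`. -/
def funkMetric {n : ℕ} (K : Set (EuclideanSpace ℝ (Fin n))) (p : EuclideanSpace ℝ (Fin n)) :
    EuclideanSpace ℝ (Fin n) → ℝ :=
  gauge {v : EuclideanSpace ℝ (Fin n) | p + v ∈ K}

/-- The area function `r(p) = ∫ 1 μ_p` of the Funk space of `K`: the area of the indicatrix
hypersurface of `L_p`. It is considered for `p` in the interior of `K`. -/
def areaFunction {n : ℕ} (K : Set (EuclideanSpace ℝ (Fin n)))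
    (p : EuclideanSpace ℝ (Fin n)) : ℝ :=
  indicatrixIntegral (funkMetric K p) fun _ => 1

end

/-!
The proof reduces both sides to integrals over the one hypersurface `∂K` and compares the integrands.

Write `L = gauge K`, `a = dL_z` at a boundary point `z`, and `c = 1 - a(p) > 0` for `p` in the
interior of `K`. The Minkowski functional `F` seen from `p` solves `L (v + F v • p) = F v`, so
`v ↦ v + F v • p` inverts `x ↦ x - L x • p`, and two derivatives of `F` at `z - p` can be computed
without an implicit function theorem: `dF = c⁻¹ a` and `d²F(u, e) = c⁻¹ d²L(A u, A e)` with
`A u = u + c⁻¹ a(u) p` (`hasFDerivAt_of_fixedPoint`, `fderiv_fderiv_of_fixedPoint`). Because of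
Euler's relations `a(z) = 1` and `d²L(z, ·) = 0`, the determinant of the metric is multiplied by
`c ^ (-(n + 1))` (`det_conformal_change`), and the density of `μ` by `c ^ (-(n - 1) / 2)`
(`indicatrixDensity_of_fixedPoint`). Translating `∂K_p` to `∂K` therefore gives
`r(p) = ∫_{∂K} φ(dL_z(p)) μ` with `φ(s) = (1 - s) ^ (-(n - 1) / 2)` (`areaFunction_eq`).

With `k = (n - 1) / 2`, the convexity estimate `1 + k s ≤ φ(s)` yields `r(0) + k β(p) ≤ r(p)`, so
a balanced body has its minimum at the origin. Conversely `φ(s) ≤ 1 + k s + O(s²)` yields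
`r(t v) ≤ r(0) + k t β(v) + O(t²)`; at a minimum this forces `β(v) ≥ 0` for every `v`, and
`β(-v) = -β(v)` then gives `β = 0`.

All of these integrals are finite because the indicatrix has finite area, being a finite union of
Lipschitz images of balls of dimension `n - 1` (`euclideanHausdorffMeasure_indicatrix_lt_top`).
-/

open Filter Topology

/-! ### Differentials of positively homogeneous functionals -/

section Homogeneous

variable {E : Type*} [NormedAddCommGroup E] [NormedSpace ℝ E] {L : E → ℝ}

theorem fderiv_smul_of_posHomogeneous (hom : ∀ t : ℝ, 0 ≤ t → ∀ x, L (t • x) = t * L x)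
    {t : ℝ} (ht : 0 < t) (x : E) : fderiv ℝ L (t • x) = fderiv ℝ L x := by
  have h1 : fderiv ℝ (fun y => L (t • y)) x = t • fderiv ℝ L (t • x) := by
    simpa using fderiv_comp_smul (𝕜 := ℝ) (f := L) t (x := x)
  have h2 : (fun y => L (t • y)) = fun y => t • L y := by
    funext y; simp [hom t ht.le y]
  have h3 : fderiv ℝ (fun y => t • L y) x = t • fderiv ℝ L x :=
    congrFun (fderiv_const_smul_field (𝕜 := ℝ) (f := L) t) x
  rw [h2, h3] at h1
  exact (smul_right_injective _ ht.ne' h1).symm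

theorem fderiv_apply_self_of_posHomogeneous (hom : ∀ t : ℝ, 0 ≤ t → ∀ x, L (t • x) = t * L x)
    {x : E} (hx : DifferentiableAt ℝ L x) : fderiv ℝ L x x = L x := by
  have h1 : HasDerivAt (fun t : ℝ => L (t • x)) (fderiv ℝ L x x) 1 := by
    have hl : HasDerivAt (fun t : ℝ => t • x) x 1 := by
      simpa using (hasDerivAt_id (1 : ℝ)).smul_const x
    have hx' : HasFDerivAt L (fderiv ℝ L x) ((1 : ℝ) • x) := by
      rw [one_smul]; exact hx.hasFDerivAt
    exact hx'.comp_hasDerivAt 1 hl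
  have h2 : HasDerivAt (fun t : ℝ => t * L x) (L x) 1 := by
    simpa using (hasDerivAt_id (1 : ℝ)).mul_const (L x)
  refine h1.unique (h2.congr_of_eventuallyEq ?_)
  filter_upwards [lt_mem_nhds one_pos] with t ht using hom t ht.le x

theorem fderiv_fderiv_apply_self_of_posHomogeneous
    (hom : ∀ t : ℝ, 0 ≤ t → ∀ x, L (t • x) = t * L x) {x : E}
    (hx : DifferentiableAt ℝ (fderiv ℝ L) x) : fderiv ℝ (fderiv ℝ L) x x = 0 := by
  have h1 : HasDerivAt (fun t : ℝ => fderiv ℝ L (t • x)) (fderiv ℝ (fderiv ℝ L) x x) 1 := by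
    have hl : HasDerivAt (fun t : ℝ => t • x) x 1 := by
      simpa using (hasDerivAt_id (1 : ℝ)).smul_const x
    have hx' : HasFDerivAt (fderiv ℝ L) (fderiv ℝ (fderiv ℝ L) x) ((1 : ℝ) • x) := by
      rw [one_smul]; exact hx.hasFDerivAt
    exact hx'.comp_hasDerivAt 1 hl
  refine h1.unique ((hasDerivAt_const (1 : ℝ) (fderiv ℝ L x)).congr_of_eventuallyEq ?_)
  filter_upwards [lt_mem_nhds one_pos] with t ht using fderiv_smul_of_posHomogeneous hom ht x

/-- A sublinear functional dominates each of its differentials. -/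
theorem fderiv_apply_le_of_sublinear (hom : ∀ t : ℝ, 0 ≤ t → ∀ x, L (t • x) = t * L x)
    (sub : ∀ x y, L (x + y) ≤ L x + L y) {x : E} (hx : DifferentiableAt ℝ L x) (v : E) :
    fderiv ℝ L x v ≤ L v := by
  have h := hx.hasFDerivAt.hasLineDerivAt v
  have ht := (hasDerivAt_iff_tendsto_slope_zero.1 h).mono_left
    (nhdsWithin_mono 0 (fun t (ht : 0 < t) => ht.ne') : 𝓝[>] (0 : ℝ) ≤ 𝓝[≠] 0)
  refine le_of_tendsto ht ?_
  filter_upwards [self_mem_nhdsWithin] with t (ht : 0 < t)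
  have := sub x (t • v)
  rw [hom t ht.le] at this
  simp only [zero_add, zero_smul, add_zero, smul_eq_mul]
  rw [inv_mul_le_iff₀ ht]
  linarith

end Homogeneous

/-! ### Derivatives of the functional seen from another base point -/

section FixedPoint

variable {E : Type*} [NormedAddCommGroup E] [NormedSpace ℝ E] {L F : E → ℝ} {p w : E}

/-- The rank one perturbation `x ↦ x - a x • p` of the identity as a continuous linear equivalence;
its inverse is `x ↦ x + (1 - a p)⁻¹ * a x • p`. It is the differential of `x ↦ x - L x • p` when
`a` is that of `L`. -/
noncomputable def shearEquiv (a : E →L[ℝ] ℝ) (p : E) (h : a p < 1) : E ≃L[ℝ] E :=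
  ContinuousLinearEquiv.equivOfInverse
    (ContinuousLinearMap.id ℝ E - a.smulRight p)
    (ContinuousLinearMap.id ℝ E + ((1 - a p)⁻¹ • a).smulRight p)
    (fun x => by
      have : 1 - a p ≠ 0 := by linarith
      simp only [sub_apply, add_apply,
        ContinuousLinearMap.id_apply, ContinuousLinearMap.smulRight_apply,
        smul_apply, map_sub, map_smul, smul_eq_mul]
      match_scalars
      · rfl
      · field_simp
        ring)
    (fun x => by
      have : 1 - a p ≠ 0 := by linarith
      simp only [sub_apply, add_apply,
        ContinuousLinearMap.id_apply, ContinuousLinearMap.smulRight_apply,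
        smul_apply, map_add, map_smul, smul_eq_mul]
      match_scalars
      · rfl
      · field_simp
        ring)

/-- The map `v ↦ v + F v • p` is a continuous right inverse of `x ↦ x - L x • p`, hence
differentiable with the inverse derivative. -/
theorem hasFDerivAt_shift_of_fixedPoint (hF : ContinuousAt F w)
    (hfix : ∀ v, L (v + F v • p) = F v)
    (hL : DifferentiableAt ℝ L (w + F w • p)) (hp : fderiv ℝ L (w + F w • p) p < 1) :
    HasFDerivAt (fun v => v + F v • p) (ContinuousLinearMap.id ℝ E +
      ((1 - fderiv ℝ L (w + F w • p) p)⁻¹ • fderiv ℝ L (w + F w • p)).smulRight p) w := by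
  have hΦ : HasFDerivAt (fun x => x - L x • p)
      (shearEquiv (fderiv ℝ L (w + F w • p)) p hp : E →L[ℝ] E) (w + F w • p) :=
    (hasFDerivAt_id _).sub (hL.hasFDerivAt.smul_const p)
  refine HasFDerivAt.of_local_left_inverse (g := fun v => v + F v • p) ?_ hΦ ?_
  · exact continuousAt_id.add (hF.smul continuousAt_const)
  · exact Eventually.of_forall fun v => by simp [hfix v]

theorem hasFDerivAt_of_fixedPoint (hF : ContinuousAt F w)
    (hfix : ∀ v, L (v + F v • p) = F v)
    (hL : DifferentiableAt ℝ L (w + F w • p)) (hp : fderiv ℝ L (w + F w • p) p < 1) :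
    HasFDerivAt F ((1 - fderiv ℝ L (w + F w • p) p)⁻¹ • fderiv ℝ L (w + F w • p)) w := by
  have h := hL.hasFDerivAt.comp w (hasFDerivAt_shift_of_fixedPoint hF hfix hL hp)
  have hc : (1 - fderiv ℝ L (w + F w • p) p) ≠ 0 := by linarith
  have hFL : (L ∘ fun v => v + F v • p) = F := funext hfix
  rw [hFL] at h
  refine h.congr_fderiv ?_
  ext u
  simp only [smul_apply, smul_eq_mul, ContinuousLinearMap.comp_apply, add_apply,
    ContinuousLinearMap.id_apply, ContinuousLinearMap.smulRight_apply, map_add, map_smul]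
  field_simp
  ring

/-- The formula for `dF` holds on a neighbourhood of `w`; differentiating it once more expresses the
Hessian of `F` through that of `L`. -/
theorem fderiv_fderiv_of_fixedPoint (hF : Continuous F)
    (hfix : ∀ v, L (v + F v • p) = F v)
    (hL : ContDiffAt ℝ 2 L (w + F w • p)) (hp : fderiv ℝ L (w + F w • p) p < 1) :
    DifferentiableAt ℝ (fderiv ℝ F) w ∧ ∀ u e : E,
      fderiv ℝ (fderiv ℝ F) w u e = (1 - fderiv ℝ L (w + F w • p) p)⁻¹ *
        fderiv ℝ (fderiv ℝ L) (w + F w • p)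
          (u + ((1 - fderiv ℝ L (w + F w • p) p)⁻¹ * fderiv ℝ L (w + F w • p) u) • p)
          (e + ((1 - fderiv ℝ L (w + F w • p) p)⁻¹ * fderiv ℝ L (w + F w • p) e) • p) := by
  have hΨ : Continuous fun v => v + F v • p := continuous_id.add (hF.smul continuous_const)
  have hdL : DifferentiableAt ℝ (fderiv ℝ L) (w + F w • p) :=
    (hL.fderiv_right (m := 1) (by norm_num)).differentiableAt (by norm_num)
  have hdiff : ∀ᶠ x in 𝓝 (w + F w • p), DifferentiableAt ℝ L x := by
    filter_upwards [hL.eventually (by simp)] with x hx using hx.differentiableAt (by norm_num)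
  have hlt : ∀ᶠ x in 𝓝 (w + F w • p), fderiv ℝ L x p < 1 :=
    ((hdL.continuousAt).clm_apply continuousAt_const).eventually_lt continuousAt_const hp
  have heq : (fun v => (1 - fderiv ℝ L (v + F v • p) p)⁻¹ • fderiv ℝ L (v + F v • p))
      =ᶠ[𝓝 w] fderiv ℝ F := by
    filter_upwards [hΨ.continuousAt.eventually hdiff, hΨ.continuousAt.eventually hlt] with v h1 h2
    exact (hasFDerivAt_of_fixedPoint hF.continuousAt hfix h1 h2).fderiv.symm
  have hc : (1 - fderiv ℝ L (w + F w • p) p) ≠ 0 := by linarith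
  have hA := hdL.hasFDerivAt.comp w (hasFDerivAt_shift_of_fixedPoint hF.continuousAt hfix
    hdiff.self_of_nhds hp)
  have hinv := ((hasDerivAt_inv hc).comp_hasFDerivAt w
    ((hA.clm_apply (hasFDerivAt_const p w)).const_sub 1))
  have key := (hinv.smul hA).congr_of_eventuallyEq heq.symm
  refine ⟨key.differentiableAt, fun u e => ?_⟩
  rw [key.fderiv]
  simp
  field_simp
  ring

end FixedPoint

/-! ### The determinant under a change of base point -/

section Determinant

open Matrix

theorem det_one_add_vecMulVec {m : Type*} [Fintype m] [DecidableEq m] (u v : m → ℝ) :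
    (1 + vecMulVec u v).det = 1 + v ⬝ᵥ u := by
  rw [vecMulVec_eq Unit, det_one_add_replicateCol_mul_replicateRow]

/-- Here `a` stands for the differential of `L` at a point `z` of the indicatrix, `H` for its Hessian,
so that the metric is `a aᵀ + H`; the matrix on the left is the metric seen from `p`. Both
determinant factors come from rank one perturbations of the identity. -/
theorem det_conformal_change {m : Type*} [Fintype m] [DecidableEq m] {H : Matrix m m ℝ}
    {a z p : m → ℝ} {c : ℝ} (hz : H *ᵥ z = 0) (haz : a ⬝ᵥ z = 1) (hc : c = 1 - a ⬝ᵥ p)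
    (hc0 : c ≠ 0) :
    (vecMulVec (c⁻¹ • a) (c⁻¹ • a) +
        c⁻¹ • ((1 + vecMulVec p (c⁻¹ • a))ᵀ * H * (1 + vecMulVec p (c⁻¹ • a)))).det =
      (c ^ (Fintype.card m + 1))⁻¹ * (vecMulVec a a + H).det := by
  have hap : a ⬝ᵥ p = 1 - c := by linarith
  obtain ⟨A, hA⟩ : ∃ A : Matrix m m ℝ, A = 1 + vecMulVec p (c⁻¹ • a) := ⟨_, rfl⟩
  rw [← hA]
  have hdetA : A.det = c⁻¹ := by
    rw [hA, det_one_add_vecMulVec, smul_dotProduct, hap, smul_eq_mul]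
    field_simp
    ring
  have h1 : a ᵥ* A = c⁻¹ • a := by
    rw [hA, vecMul_add, vecMul_one, vecMul_vecMulVec, hap]
    ext i
    simp
    field_simp
    ring
  have h2 : Aᵀ *ᵥ a = c⁻¹ • a := by rw [mulVec_transpose, h1]
  have h3 : vecMulVec (c⁻¹ • a) (c⁻¹ • a) + c⁻¹ • (Aᵀ * H * A) =
      Aᵀ * (c⁻¹ • ((vecMulVec a a + H) * (1 + vecMulVec ((c - 1) • z) a))) * A := by
    -- `(a aᵀ + H) z = a`, so the right factor only rescales the term `a aᵀ`.
    have h4 : c⁻¹ • ((vecMulVec a a + H) * (1 + vecMulVec ((c - 1) • z) a)) =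
        vecMulVec a a + c⁻¹ • H := by
      rw [mul_add, mul_one, mul_vecMulVec, mulVec_smul, add_mulVec, hz, add_zero,
        vecMulVec_mulVec, haz]
      ext i j
      simp [vecMulVec_apply]
      field_simp
      ring
    rw [h4, mul_add, add_mul, mul_vecMulVec, h2, vecMulVec_mul, h1]
    simp
  rw [h3, det_mul, det_mul, det_transpose, det_smul, det_mul, det_one_add_vecMulVec, hdetA,
    dotProduct_smul, haz]
  simp
  field_simp
  ring

end Determinant

/-! ### The metric in terms of the derivatives of the functional -/

section Metric

open Matrix

variable {n : ℕ} {L : EuclideanSpace ℝ (Fin n) → ℝ}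

theorem EuclideanSpace.linearMap_apply_eq_dotProduct (ℓ : EuclideanSpace ℝ (Fin n) →L[ℝ] ℝ)
    (x : EuclideanSpace ℝ (Fin n)) :
    ℓ x = (fun i => ℓ (EuclideanSpace.single i 1)) ⬝ᵥ x.ofLp := by
  conv_lhs => rw [← (EuclideanSpace.basisFun (Fin n) ℝ).sum_repr x]
  simp [dotProduct, mul_comm]

theorem EuclideanSpace.bilinear_apply_eq_dotProduct
    (D : EuclideanSpace ℝ (Fin n) →L[ℝ] EuclideanSpace ℝ (Fin n) →L[ℝ] ℝ)
    (x y : EuclideanSpace ℝ (Fin n)) :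
    D x y = y.ofLp ⬝ᵥ ((Matrix.of fun i j =>
      D (EuclideanSpace.single j 1) (EuclideanSpace.single i 1)) *ᵥ x.ofLp) := by
  rw [EuclideanSpace.linearMap_apply_eq_dotProduct (D x) y, dotProduct_comm]
  congr 1
  funext i
  exact EuclideanSpace.linearMap_apply_eq_dotProduct
    (D.flip (EuclideanSpace.single i 1)) x

/-- `g = dL ⊗ dL + L d²L`. The index `i` is the direction of the inner derivative; no symmetry of
the second derivative is used. -/
theorem finslerMetric_eq {y : EuclideanSpace ℝ (Fin n)}
    (hL : ∀ᶠ x in 𝓝 y, DifferentiableAt ℝ L x) (h2 : DifferentiableAt ℝ (fderiv ℝ L) y) :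
    finslerMetric L y =
      vecMulVec (fun i => fderiv ℝ L y (EuclideanSpace.single i 1))
        (fun i => fderiv ℝ L y (EuclideanSpace.single i 1)) +
      L y • Matrix.of fun i j => fderiv ℝ (fderiv ℝ L) y
        (EuclideanSpace.single j 1) (EuclideanSpace.single i 1) := by
  ext i j
  have h1 : (fun z => fderiv ℝ (energy L) z (EuclideanSpace.single i (1 : ℝ))) =ᶠ[𝓝 y]
      fun z => L z * fderiv ℝ L z (EuclideanSpace.single i (1 : ℝ)) := by
    filter_upwards [hL] with z hz
    have : HasFDerivAt (energy L) (L z • fderiv ℝ L z) z := by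
      refine ((hz.hasFDerivAt.pow 2).const_mul (1 / 2)).congr_fderiv ?_
      ext u
      simp
      ring
    simp [this.fderiv]
  have h3 := hL.self_of_nhds.hasFDerivAt.mul
    (h2.hasFDerivAt.clm_apply (hasFDerivAt_const (EuclideanSpace.single i (1 : ℝ)) y))
  have h4 : finslerMetric L y i j = _ := congrArg (fun ℓ => ℓ (EuclideanSpace.single j (1 : ℝ)))
    (h1.fderiv_eq.trans h3.fderiv)
  rw [h4]
  simp [vecMulVec_apply]
  ring

end Metric

/-! ### The density of the volume form on the indicatrix -/

section Density

open Matrix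

variable {n : ℕ} {L F : EuclideanSpace ℝ (Fin n) → ℝ}

theorem det_finslerMetric_of_fixedPoint {p z : EuclideanSpace ℝ (Fin n)}
    (hom : ∀ t : ℝ, 0 ≤ t → ∀ x, L (t • x) = t * L x) (hF : Continuous F)
    (hfix : ∀ v, L (v + F v • p) = F v) (hFz : F (z - p) = 1) (hLz : L z = 1)
    (hL : ContDiffAt ℝ 2 L z) (hp : fderiv ℝ L z p < 1) :
    (finslerMetric F (z - p)).det =
      ((1 - fderiv ℝ L z p) ^ (n + 1))⁻¹ * (finslerMetric L z).det := by
  have hz : z - p + F (z - p) • p = z := by rw [hFz, one_smul, sub_add_cancel]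
  have hdL : DifferentiableAt ℝ (fderiv ℝ L) z :=
    (hL.fderiv_right (m := 1) (by norm_num)).differentiableAt (by norm_num)
  have hdiff : ∀ᶠ x in 𝓝 z, DifferentiableAt ℝ L x := by
    filter_upwards [hL.eventually (by simp)] with x hx using hx.differentiableAt (by norm_num)
  have hlt : ∀ᶠ x in 𝓝 z, fderiv ℝ L x p < 1 :=
    ((hdL.continuousAt).clm_apply continuousAt_const).eventually_lt continuousAt_const hp
  have hΨ : Tendsto (fun v => v + F v • p) (𝓝 (z - p)) (𝓝 z) := by
    have : Continuous fun v => v + F v • p := continuous_id.add (hF.smul continuous_const)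
    exact this.tendsto' _ _ hz
  have hFdiff : ∀ᶠ v in 𝓝 (z - p), DifferentiableAt ℝ F v := by
    filter_upwards [hΨ.eventually hdiff, hΨ.eventually hlt] with v h1 h2
    exact (hasFDerivAt_of_fixedPoint hF.continuousAt hfix h1 h2).differentiableAt
  have hF1 : fderiv ℝ F (z - p) = (1 - fderiv ℝ L z p)⁻¹ • fderiv ℝ L z := by
    have := hasFDerivAt_of_fixedPoint (w := z - p) hF.continuousAt hfix
      (by rw [hz]; exact hdiff.self_of_nhds) (by rw [hz]; exact hp)
    rw [hz] at this
    exact this.fderiv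
  obtain ⟨hF2, hF3⟩ := fderiv_fderiv_of_fixedPoint (w := z - p) hF hfix (by rw [hz]; exact hL)
    (by rw [hz]; exact hp)
  rw [hz] at hF3
  rw [finslerMetric_eq hdiff hdL, finslerMetric_eq hFdiff hF2, hLz, hFz, hF1, one_smul, one_smul]
  set a : Fin n → ℝ := fun i => fderiv ℝ L z (EuclideanSpace.single i 1) with ha
  set H : Matrix (Fin n) (Fin n) ℝ := Matrix.of fun i j => fderiv ℝ (fderiv ℝ L) z
        (EuclideanSpace.single j 1) (EuclideanSpace.single i 1) with hH
  have hap : ∀ x : EuclideanSpace ℝ (Fin n), fderiv ℝ L z x = a ⬝ᵥ x.ofLp :=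
    EuclideanSpace.linearMap_apply_eq_dotProduct _
  have hDH : ∀ x y : EuclideanSpace ℝ (Fin n), fderiv ℝ (fderiv ℝ L) z x y =
      y.ofLp ⬝ᵥ (H *ᵥ x.ofLp) := EuclideanSpace.bilinear_apply_eq_dotProduct _
  have hHz : H *ᵥ z.ofLp = 0 := by
    funext i
    have := hDH z (EuclideanSpace.single i 1)
    rw [fderiv_fderiv_apply_self_of_posHomogeneous hom hdL] at this
    simpa using this.symm
  have haz : a ⬝ᵥ z.ofLp = 1 := by
    rw [← hap, fderiv_apply_self_of_posHomogeneous hom hdiff.self_of_nhds, hLz]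
  set c : ℝ := 1 - fderiv ℝ L z p with hc
  have hc0 : c ≠ 0 := by rw [hc]; linarith
  have key := det_conformal_change hHz haz (by rw [hc, hap]) hc0 (p := p.ofLp)
  rw [Fintype.card_fin] at key
  rw [← key]
  congr 2
  ext i j
  have hcol : ∀ j, (EuclideanSpace.single j (1 : ℝ) +
      (c⁻¹ * fderiv ℝ L z (EuclideanSpace.single j 1)) • p).ofLp =
      fun k => (1 + vecMulVec p.ofLp (c⁻¹ • a)) k j := by
    intro j
    funext k
    simp [vecMulVec_apply, ha, Matrix.one_apply]
    ring
  simp only [Matrix.of_apply, hF3, hDH, hcol, Matrix.smul_apply, smul_eq_mul, mul_assoc]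
  rfl

theorem inner_outerNormal (L : EuclideanSpace ℝ (Fin n) → ℝ) (x y : EuclideanSpace ℝ (Fin n)) :
    inner ℝ x (outerNormal L y) = ‖gradient L y‖⁻¹ * fderiv ℝ L y x := by
  rw [outerNormal, inner_smul_right, inner_gradient_right]
  simp

/-- Moving the base point to `p` multiplies the density of `μ` at a boundary point `z` by
`(1 - dL_z(p)) ^ (-(n - 1) / 2)`. -/
theorem indicatrixDensity_of_fixedPoint {p z : EuclideanSpace ℝ (Fin n)}
    (hom : ∀ t : ℝ, 0 ≤ t → ∀ x, L (t • x) = t * L x) (hF : Continuous F)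
    (hfix : ∀ v, L (v + F v • p) = F v) (hFz : F (z - p) = 1) (hLz : L z = 1)
    (hL : ContDiffAt ℝ 2 L z) (hp : fderiv ℝ L z p < 1) :
    indicatrixDensity F (z - p) =
      (1 - fderiv ℝ L z p) ^ (-(((n : ℝ) - 1) / 2)) * indicatrixDensity L z := by
  have hz : z - p + F (z - p) • p = z := by rw [hFz, one_smul, sub_add_cancel]
  have hdiff : DifferentiableAt ℝ L z := hL.differentiableAt (by norm_num)
  have hF1 : fderiv ℝ F (z - p) = (1 - fderiv ℝ L z p)⁻¹ • fderiv ℝ L z := by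
    have := hasFDerivAt_of_fixedPoint (w := z - p) hF.continuousAt hfix
      (by rw [hz]; exact hdiff) (by rw [hz]; exact hp)
    rw [hz] at this
    exact this.fderiv
  have hgrad : gradient F (z - p) = (1 - fderiv ℝ L z p)⁻¹ • gradient L z := by
    simp [gradient, hF1]
  have hz1 : fderiv ℝ L z z = 1 := by
    rw [fderiv_apply_self_of_posHomogeneous hom hdiff, hLz]
  unfold indicatrixDensity
  rw [inner_outerNormal, inner_outerNormal, hgrad, hF1,
    det_finslerMetric_of_fixedPoint hom hF hfix hFz hLz hL hp, norm_smul, _root_.smul_apply,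
    map_sub, hz1]
  obtain ⟨c, hc⟩ : ∃ c, c = 1 - fderiv ℝ L z p := ⟨_, rfl⟩
  have hc0 : 0 < c := by rw [hc]; linarith
  rw [← hc, Real.sqrt_mul (by positivity), Real.norm_of_nonneg (by positivity), smul_eq_mul]
  have hpow : √((c ^ (n + 1))⁻¹) = c ^ (-(((n : ℝ) - 1) / 2)) * c⁻¹ := by
    rw [← Real.rpow_natCast, ← Real.rpow_neg hc0.le, Real.sqrt_eq_rpow, ← Real.rpow_mul hc0.le,
      ← Real.rpow_neg_one c, ← Real.rpow_add hc0]
    congr 1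
    push_cast
    ring
  rw [hpow]
  field_simp

theorem indicatrixDensity_nonneg (hom : ∀ t : ℝ, 0 ≤ t → ∀ x, L (t • x) = t * L x)
    {z : EuclideanSpace ℝ (Fin n)} (hLz : L z = 1) (hL : DifferentiableAt ℝ L z) :
    0 ≤ indicatrixDensity L z := by
  rw [indicatrixDensity, inner_outerNormal, fderiv_apply_self_of_posHomogeneous hom hL, hLz]
  positivity

theorem continuousAt_indicatrixDensity (hom : ∀ t : ℝ, 0 ≤ t → ∀ x, L (t • x) = t * L x)
    {z : EuclideanSpace ℝ (Fin n)} (hLz : L z = 1) (hL : ContDiffAt ℝ 2 L z) :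
    ContinuousAt (indicatrixDensity L) z := by
  have h2 : ContDiffAt ℝ 1 (fderiv ℝ L) z := hL.fderiv_right (by norm_num)
  have h3 : ContinuousAt (fderiv ℝ (fderiv ℝ L)) z :=
    (h2.fderiv_right (m := 0) (by norm_num)).continuousAt
  have hgrad : ContinuousAt (gradient L) z :=
    ((InnerProductSpace.toDual ℝ (EuclideanSpace ℝ (Fin n))).symm.continuous.continuousAt).comp
      h2.continuousAt
  -- Euler's relation `dL_z z = 1` keeps the gradient away from zero.
  have hgrad0 : gradient L z ≠ 0 := by
    intro h
    have h1 := fderiv_apply_self_of_posHomogeneous hom (hL.differentiableAt (by norm_num))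
    rw [← inner_gradient_left, h, inner_zero_left, hLz] at h1
    exact zero_ne_one h1
  have hG : ContinuousAt (finslerMetric L) z := by
    have heq : (fun y => vecMulVec (fun i => fderiv ℝ L y (EuclideanSpace.single i 1))
        (fun i => fderiv ℝ L y (EuclideanSpace.single i 1)) +
      L y • Matrix.of fun i j => fderiv ℝ (fderiv ℝ L) y
        (EuclideanSpace.single j 1) (EuclideanSpace.single i 1)) =ᶠ[𝓝 z] finslerMetric L := by
      filter_upwards [(hL.eventually (by simp)).eventually_nhds] with y hy
      refine (finslerMetric_eq ?_ ?_).symm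
      · filter_upwards [hy] with x hx using hx.differentiableAt (by norm_num)
      · exact (hy.self_of_nhds.fderiv_right (m := 1) (by norm_num)).differentiableAt (by norm_num)
    refine ContinuousAt.congr ?_ heq
    have h1 : ∀ v, ContinuousAt (fun y => fderiv ℝ L y v) z := fun v =>
      h2.continuousAt.clm_apply continuousAt_const
    refine continuousAt_pi.2 fun i => continuousAt_pi.2 fun j => ?_
    exact ((h1 _).mul (h1 _)).add (hL.continuousAt.mul
      ((h3.clm_apply continuousAt_const).clm_apply continuousAt_const))
  have hdet : ContinuousAt (fun y => (finslerMetric L y).det) z :=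
    (Continuous.matrix_det continuous_id).continuousAt.comp hG
  exact hdet.sqrt.mul (continuousAt_id.inner
    ((hgrad.norm.inv₀ (norm_ne_zero_iff.2 hgrad0)).smul hgrad))

end Density

/-! ### Finiteness of the area of the indicatrix -/

section FiniteArea

open Set

/-- The indicatrix is covered by the radial images of balls lying in the hyperplanes `x i = ± 1`,
and the radial projection `x ↦ x / L x` is Lipschitz on each of them. -/
theorem euclideanHausdorffMeasure_indicatrix_lt_top {m : ℕ}
    {L : EuclideanSpace ℝ (Fin (m + 1)) → ℝ} (hom : ∀ t : ℝ, 0 ≤ t → ∀ x, L (t • x) = t * L x)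
    (hpos : ∀ x, x ≠ 0 → 0 < L x) (hL : ∀ x, x ≠ 0 → ContDiffAt ℝ 1 L x) :
    μHE[m] (indicatrix L) < ⊤ := by
  -- `ψ i s` parametrizes the hyperplane `x i = s`, and `f i s` is its radial image.
  let ψ : Fin (m + 1) → ℝ → EuclideanSpace ℝ (Fin m) → EuclideanSpace ℝ (Fin (m + 1)) :=
    fun i s u => WithLp.toLp 2 (i.insertNth s u.ofLp)
  have hψi : ∀ i s u, ψ i s u i = s := fun i s u => by simp [ψ]
  have hψ : ∀ i s, ContDiff ℝ 1 (ψ i s) := by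
    intro i s
    refine contDiff_euclidean.2 fun j => ?_
    rcases eq_or_ne j i with rfl | hj
    · simpa [ψ] using contDiff_const
    · obtain ⟨k, rfl⟩ := Fin.exists_succAbove_eq hj
      simp only [ψ, Fin.insertNth_apply_succAbove]
      fun_prop
  let f : Fin (m + 1) → ℝ → EuclideanSpace ℝ (Fin m) → EuclideanSpace ℝ (Fin (m + 1)) :=
    fun i s u => (L (ψ i s u))⁻¹ • ψ i s u
  have hψ0 : ∀ i s u, s ≠ 0 → ψ i s u ≠ 0 := by
    intro i s u hs h
    apply hs
    rw [← hψi i s u, h]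
    rfl
  have hf : ∀ i s, s ≠ 0 → ContDiff ℝ 1 (f i s) := by
    intro i s hs
    rw [contDiff_iff_contDiffAt]
    intro u
    have h0 := hψ0 i s u hs
    exact (((hL _ h0).comp u (hψ i s).contDiffAt).inv (hpos _ h0).ne').smul (hψ i s).contDiffAt
  let B : Set (EuclideanSpace ℝ (Fin m)) := Metric.closedBall 0 (√m)
  have hB : IsCompact B := isCompact_closedBall _ _
  have hfin : ∀ i s, s ≠ 0 → μHE[m] (f i s '' B) < ⊤ := by
    intro i s hs
    obtain ⟨C, hC⟩ := ((hf i s hs).locallyLipschitz.locallyLipschitzOn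
      (s := B)).exists_lipschitzOnWith_of_compact hB
    have h1 := hC.hausdorffMeasure_image_le (d := m) (Nat.cast_nonneg m)
    have h2 : μH[(m : ℝ)] B < ⊤ := by
      have := hB.measure_lt_top (μ := μH[(Module.finrank ℝ (EuclideanSpace ℝ (Fin m)) : ℝ)])
      rwa [finrank_euclideanSpace_fin] at this
    have h3 : μH[(m : ℝ)] (f i s '' B) < ⊤ :=
      h1.trans_lt (ENNReal.mul_lt_top (ENNReal.rpow_lt_top_of_nonneg (Nat.cast_nonneg m)
        ENNReal.coe_ne_top) h2)
    rw [Measure.euclideanHausdorffMeasure_def, Measure.smul_apply, ENNReal.smul_def, smul_eq_mul]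
    exact ENNReal.mul_lt_top ENNReal.coe_lt_top h3
  have hcover : indicatrix L ⊆ ⋃ i, (f i 1 '' B ∪ f i (-1) '' B) := by
    intro x hx
    have hx1 : L x = 1 := hx
    -- Project `x` radially to the face of the cube of a coordinate of largest modulus.
    obtain ⟨i, hi⟩ := Finite.exists_max fun i => |x i|
    have hxi : 0 < |x i| := by
      rw [abs_pos]
      intro h0
      have : x = 0 := by
        ext j
        have := hi j
        rw [h0, abs_zero] at this
        exact abs_nonpos_iff.1 this
      have h2 := hom 0 le_rfl 0
      rw [zero_smul, zero_mul, ← this, hx1] at h2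
      exact one_ne_zero h2
    have hmem : ∀ s, s = |x i|⁻¹ * x i → x ∈ f i s '' B := by
      intro s hs
      let u : EuclideanSpace ℝ (Fin m) := WithLp.toLp 2 fun k => |x i|⁻¹ * x (i.succAbove k)
      have hψu : ψ i s u = |x i|⁻¹ • x := by
        ext j
        rcases eq_or_ne j i with rfl | hj
        · rw [hψi, hs]
          rfl
        · obtain ⟨k, rfl⟩ := Fin.exists_succAbove_eq hj
          simp [ψ, u]
      refine ⟨u, ?_, ?_⟩
      · rw [mem_closedBall_zero_iff, EuclideanSpace.norm_eq]
        refine Real.sqrt_le_sqrt ?_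
        have : ∀ k, ‖u k‖ ^ 2 ≤ 1 := by
          intro k
          have : ‖u k‖ ≤ 1 := by
            simp only [u, norm_mul, norm_inv, Real.norm_eq_abs, abs_abs]
            rw [inv_mul_le_iff₀ hxi, mul_one]
            exact hi _
          exact pow_le_one₀ (norm_nonneg _) this
        exact (Finset.sum_le_sum fun k _ => this k).trans (by simp)
      · simp only [f]
        rw [hψu, hom _ (by positivity), hx1, mul_one, inv_inv, smul_smul,
          mul_inv_cancel₀ hxi.ne', one_smul]
    refine mem_iUnion.2 ⟨i, ?_⟩
    rcases abs_cases (x i) with ⟨h, -⟩ | ⟨h, -⟩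
    · exact Or.inl (hmem 1 (by rw [h, inv_mul_cancel₀ (abs_pos.1 hxi)]))
    · exact Or.inr (hmem (-1) (by
        rw [h, inv_neg, neg_mul, inv_mul_cancel₀ (abs_pos.1 hxi)]))
  refine (measure_mono hcover).trans_lt ((measure_iUnion_fintype_le _ _).trans_lt ?_)
  refine ENNReal.sum_lt_top.2 fun i _ => (measure_union_le _ _).trans_lt ?_
  exact ENNReal.add_lt_top.2 ⟨hfin i 1 one_ne_zero, hfin i (-1) (by norm_num)⟩

end FiniteArea

/-! ### Estimates for `(1 - s) ^ (-k)` -/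

section Scalar

theorem one_add_mul_le_one_sub_rpow_neg {k s : ℝ} (hk : 0 ≤ k) (hs : s < 1) :
    1 + k * s ≤ (1 - s) ^ (-k) := by
  have h0 : 0 < 1 - s := by linarith
  rw [Real.rpow_def_of_pos h0]
  have h1 := Real.add_one_le_exp (Real.log (1 - s) * -k)
  have h2 := Real.log_le_sub_one_of_pos h0
  nlinarith

theorem one_sub_rpow_neg_le {k s : ℝ} (hk : 0 ≤ k) (hs : |s| ≤ 1 / 2) (hks : 2 * k * |s| ≤ 1) :
    (1 - s) ^ (-k) ≤ 1 + k * s + (2 * k + 4 * k ^ 2) * s ^ 2 := by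
  obtain ⟨hs1, hs2⟩ := abs_le.1 hs
  have h0 : 0 < 1 - s := by linarith
  have hinv : (1 - s)⁻¹ ≤ 2 := by
    rw [inv_le_comm₀ h0 two_pos]
    linarith
  have hinv0 : 0 < (1 - s)⁻¹ := inv_pos.2 h0
  -- `-log (1 - s) ≤ s / (1 - s)`, so `(1 - s) ^ (-k) ≤ exp u` for this `u`.
  obtain ⟨u, hu⟩ : ∃ u, u = k * (s * (1 - s)⁻¹) := ⟨_, rfl⟩
  have hlog : -Real.log (1 - s) ≤ s * (1 - s)⁻¹ := by
    have := Real.one_sub_inv_le_log_of_pos h0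
    have h3 : s * (1 - s)⁻¹ = (1 - s)⁻¹ - 1 := by field_simp; ring
    linarith
  have hub : |u| ≤ 2 * k * |s| := by
    rw [hu, abs_mul, abs_mul, abs_of_nonneg hk, abs_of_pos hinv0]
    have : |s| * (1 - s)⁻¹ ≤ |s| * 2 := mul_le_mul_of_nonneg_left hinv (abs_nonneg _)
    nlinarith
  have hu1 : u ≤ k * s + 2 * k * s ^ 2 := by
    have h3 : s * (1 - s)⁻¹ = s + s ^ 2 * (1 - s)⁻¹ := by field_simp; ring
    have h4 : s ^ 2 * (1 - s)⁻¹ ≤ s ^ 2 * 2 := mul_le_mul_of_nonneg_left hinv (sq_nonneg _)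
    rw [hu, h3]
    nlinarith
  have hu2 : u ^ 2 ≤ 4 * k ^ 2 * s ^ 2 := by
    have := pow_le_pow_left₀ (abs_nonneg u) hub 2
    rw [sq_abs, mul_pow, mul_pow, sq_abs] at this
    linarith
  have hexp := (abs_le.1 (Real.abs_exp_sub_one_sub_id_le (hub.trans hks))).2
  have hle : (1 - s) ^ (-k) ≤ Real.exp u := by
    rw [Real.rpow_def_of_pos h0]
    exact Real.exp_le_exp.2 (by nlinarith)
  nlinarith

/-- First-order condition at a one-sided minimum along a ray. -/
theorem nonneg_of_forall_small_quadratic_nonneg {b C δ : ℝ} (hδ : 0 < δ)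
    (h : ∀ t, 0 < t → t ≤ δ → 0 ≤ t * b + C * t ^ 2) : 0 ≤ b := by
  have ht : Tendsto (fun t : ℝ => b + C * t) (𝓝[>] 0) (𝓝 b) := by
    have : Continuous fun t : ℝ => b + C * t := by fun_prop
    exact (this.tendsto' 0 b (by simp)).mono_left nhdsWithin_le_nhds
  refine ge_of_tendsto ht ?_
  filter_upwards [Ioc_mem_nhdsGT hδ] with t ht
  have := h t ht.1 ht.2
  have h0 := ht.1
  by_contra hneg
  push Not at hneg
  nlinarith

end Scalar

/-! ### The area function of a convex body -/

section Body

variable {n : ℕ} {K : Set (EuclideanSpace ℝ (Fin n))}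

/-- The defining property `L (p + v / L_p v) = 1` of the Funk metric, multiplied by `L_p v` so that it
also holds at `v = 0`. -/
theorem gauge_add_smul_funkMetric (hK : Convex ℝ K) (hb : Bornology.IsBounded K)
    (h0 : K ∈ 𝓝 0) {p : EuclideanSpace ℝ (Fin n)} (hp : p ∈ interior K)
    (v : EuclideanSpace ℝ (Fin n)) :
    gauge K (v + funkMetric K p v • p) = funkMetric K p v := by
  have hKp : Convex ℝ {v | p + v ∈ K} := hK.translate_preimage_right p
  have h0p : {v | p + v ∈ K} ∈ 𝓝 (0 : EuclideanSpace ℝ (Fin n)) :=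
    (continuous_const.add continuous_id).tendsto' (0 : EuclideanSpace ℝ (Fin n)) p (by simp)
      (mem_interior_iff_mem_nhds.1 hp)
  have hbp : Bornology.IsBounded {v | p + v ∈ K} :=
    (hb.vadd (-p)).subset fun v hv => ⟨p + v, hv, by simp⟩
  rcases eq_or_ne v 0 with rfl | hv
  · simp [funkMetric]
  have hpos : 0 < funkMetric K p v := by
    rw [funkMetric, gauge_pos (absorbent_nhds_zero h0p)
      ((NormedSpace.isVonNBounded_iff ℝ).2 hbp)]
    exact hv
  set t := funkMetric K p v with ht
  have h1 : funkMetric K p (t⁻¹ • v) = 1 := by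
    rw [funkMetric, gauge_smul_of_nonneg (by positivity), smul_eq_mul]
    exact inv_mul_cancel₀ hpos.ne'
  have h2 : p + t⁻¹ • v ∈ frontier K := by
    have h3 := (gauge_eq_one_iff_mem_frontier hKp h0p).1 h1
    have h4 := (Homeomorph.addLeft p).preimage_frontier K
    have h5 : t⁻¹ • v ∈ (Homeomorph.addLeft p) ⁻¹' frontier K := by
      rw [h4]
      exact h3
    exact h5
  have h3 := (gauge_eq_one_iff_mem_frontier hK h0).2 h2
  have h4 : v + t • p = t • (p + t⁻¹ • v) := by
    rw [smul_add, smul_smul, mul_inv_cancel₀ hpos.ne', one_smul, add_comm]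
  rw [h4, gauge_smul_of_nonneg hpos.le, h3, smul_eq_mul, mul_one]

/-- The indicatrix of `L_p` is `∂K - p`. -/
theorem indicatrix_funkMetric (hK : Convex ℝ K) (h0 : K ∈ 𝓝 0)
    {p : EuclideanSpace ℝ (Fin n)} (hp : p ∈ interior K) :
    IsometryEquiv.addRight p ⁻¹' indicatrix (gauge K) = indicatrix (funkMetric K p) := by
  have hKp : Convex ℝ {v | p + v ∈ K} := hK.translate_preimage_right p
  have h0p : {v | p + v ∈ K} ∈ 𝓝 (0 : EuclideanSpace ℝ (Fin n)) :=
    (continuous_const.add continuous_id).tendsto' (0 : EuclideanSpace ℝ (Fin n)) p (by simp)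
      (mem_interior_iff_mem_nhds.1 hp)
  have h1 : indicatrix (gauge K) = frontier K := by
    ext x
    exact gauge_eq_one_iff_mem_frontier hK h0
  have h2 : indicatrix (funkMetric K p) = frontier {v | p + v ∈ K} := by
    ext x
    exact gauge_eq_one_iff_mem_frontier hKp h0p
  have h3 : {v | p + v ∈ K} = (Homeomorph.addRight p) ⁻¹' K := by
    ext v
    simp [add_comm]
  rw [h1, h2, h3, ← (Homeomorph.addRight p).preimage_frontier K]
  rfl

theorem fderiv_gauge_apply_lt_one (hK : Convex ℝ K) (h0 : K ∈ 𝓝 0)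
    {p z : EuclideanSpace ℝ (Fin n)} (hp : p ∈ interior K)
    (hz : DifferentiableAt ℝ (gauge K) z) : fderiv ℝ (gauge K) z p < 1 :=
  (fderiv_apply_le_of_sublinear
    (fun _ ht _ => gauge_smul_of_nonneg ht _)
    (gauge_add_le hK (absorbent_nhds_zero h0)) hz p).trans_lt
    ((gauge_lt_one_iff_mem_interior hK h0).2 hp)

/-- The area function as an integral over the fixed hypersurface `∂K`. -/
theorem areaFunction_eq (hK : Convex ℝ K) (hb : Bornology.IsBounded K) (h0 : K ∈ 𝓝 0)
    (hL : ∀ x, x ≠ 0 → ContDiffAt ℝ 2 (gauge K) x)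
    {p : EuclideanSpace ℝ (Fin n)} (hp : p ∈ interior K) :
    areaFunction K p = indicatrixIntegral (gauge K) fun z =>
      (1 - fderiv ℝ (gauge K) z p) ^ (-(((n : ℝ) - 1) / 2)) := by
  have hFc : Continuous (funkMetric K p) :=
    continuous_gauge (hK.translate_preimage_right p)
      ((continuous_const.add continuous_id).tendsto' (0 : EuclideanSpace ℝ (Fin n)) p (by simp)
      (mem_interior_iff_mem_nhds.1 hp))
  unfold areaFunction indicatrixIntegral
  have hmp := (IsometryEquiv.addRight p).measurePreserving_euclideanHausdorffMeasure (n - 1)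
  rw [← hmp.setIntegral_preimage_emb
    (IsometryEquiv.addRight p).toHomeomorph.measurableEmbedding _ (indicatrix (gauge K)),
    indicatrix_funkMetric hK h0 hp]
  have hmeas : MeasurableSet (indicatrix (funkMetric K p)) :=
    (isClosed_singleton.preimage hFc).measurableSet
  refine setIntegral_congr_fun hmeas fun w hw => ?_
  have hz1 : gauge K (w + p) = 1 := by
    rw [← indicatrix_funkMetric hK h0 hp] at hw
    exact hw
  have hz0 : w + p ≠ 0 := by
    intro h
    rw [h, gauge_zero] at hz1
    exact zero_ne_one hz1
  have hd := hL _ hz0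
  have := indicatrixDensity_of_fixedPoint (L := gauge K) (F := funkMetric K p) (p := p)
    (z := w + p) (fun _ ht _ => gauge_smul_of_nonneg ht _) hFc
    (gauge_add_smul_funkMetric hK hb h0 hp) (by rw [add_sub_cancel_right]; exact hw) hz1 hd
    (fderiv_gauge_apply_lt_one hK h0 hp (hd.differentiableAt (by norm_num)))
  rw [add_sub_cancel_right] at this
  simpa using this

theorem integrableOn_mul_indicatrixDensity (hn : 1 ≤ n) (hK : Convex ℝ K) (hc : IsCompact K)
    (h0 : K ∈ 𝓝 0) (hL : ∀ x, x ≠ 0 → ContDiffAt ℝ 2 (gauge K) x)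
    {f : EuclideanSpace ℝ (Fin n) → ℝ} (hf : ContinuousOn f (indicatrix (gauge K))) :
    IntegrableOn (fun z => f z * indicatrixDensity (gauge K) z) (indicatrix (gauge K))
      μHE[n - 1] := by
  obtain ⟨m, rfl⟩ := Nat.exists_eq_add_of_le' hn
  have h1 : indicatrix (gauge K) = frontier K := by
    ext x
    exact gauge_eq_one_iff_mem_frontier hK h0
  have hcpt : IsCompact (indicatrix (gauge K)) := by
    rw [h1]
    exact hc.of_isClosed_subset isClosed_frontier hc.isClosed.frontier_subset
  refine ContinuousOn.integrableOn_of_subset_isCompact (K := indicatrix (gauge K)) ?_ hcpt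
    hcpt.measurableSet subset_rfl (ne_of_lt ?_)
  · refine hf.mul fun z hz => ContinuousAt.continuousWithinAt ?_
    have hz1 : gauge K z = 1 := hz
    refine continuousAt_indicatrixDensity (fun _ ht _ => gauge_smul_of_nonneg ht _) hz1 (hL z ?_)
    rintro rfl
    rw [gauge_zero] at hz1
    exact zero_ne_one hz1
  · refine euclideanHausdorffMeasure_indicatrix_lt_top (m := m)
      (fun _ ht _ => gauge_smul_of_nonneg ht _) (fun x hx => ?_)
      fun x hx => (hL x hx).of_le (by norm_num)
    rwa [gauge_pos (absorbent_nhds_zero h0) ((NormedSpace.isVonNBounded_iff ℝ).2 hc.isBounded)]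

theorem indicatrixIntegral_const_add_mul (hn : 1 ≤ n) (hK : Convex ℝ K) (hc : IsCompact K)
    (h0 : K ∈ 𝓝 0) (hL : ∀ x, x ≠ 0 → ContDiffAt ℝ 2 (gauge K) x)
    {f : EuclideanSpace ℝ (Fin n) → ℝ} (hf : ContinuousOn f (indicatrix (gauge K))) (b c : ℝ) :
    indicatrixIntegral (gauge K) (fun z => b + c * f z) =
      b * indicatrixIntegral (gauge K) (fun _ => 1) + c * indicatrixIntegral (gauge K) f := by
  unfold indicatrixIntegral
  have h1 := (integrableOn_mul_indicatrixDensity hn hK hc h0 hL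
    (continuousOn_const (c := (1 : ℝ)))).const_mul b
  have h2 := (integrableOn_mul_indicatrixDensity hn hK hc h0 hL hf).const_mul c
  rw [← integral_const_mul, ← integral_const_mul, ← integral_add h1 h2]
  congr 1
  funext z
  ring

theorem indicatrixIntegral_mono (hn : 1 ≤ n) (hK : Convex ℝ K) (hc : IsCompact K)
    (h0 : K ∈ 𝓝 0) (hL : ∀ x, x ≠ 0 → ContDiffAt ℝ 2 (gauge K) x)
    {f g : EuclideanSpace ℝ (Fin n) → ℝ} (hf : ContinuousOn f (indicatrix (gauge K)))
    (hg : ContinuousOn g (indicatrix (gauge K)))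
    (hfg : ∀ z, z ≠ 0 → gauge K z = 1 → f z ≤ g z) :
    indicatrixIntegral (gauge K) f ≤ indicatrixIntegral (gauge K) g := by
  have hmeas : MeasurableSet (indicatrix (gauge K)) :=
    (isClosed_singleton.preimage (continuous_gauge hK h0)).measurableSet
  refine setIntegral_mono_on (integrableOn_mul_indicatrixDensity hn hK hc h0 hL hf)
    (integrableOn_mul_indicatrixDensity hn hK hc h0 hL hg) hmeas fun z hz => ?_
  have hz1 : gauge K z = 1 := hz
  have hz0 : z ≠ 0 := by
    rintro rfl
    rw [gauge_zero] at hz1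
    exact zero_ne_one hz1
  exact mul_le_mul_of_nonneg_right (hfg z hz0 hz1)
    (indicatrixDensity_nonneg (fun _ ht _ => gauge_smul_of_nonneg ht _) hz1
      ((hL z hz0).differentiableAt (by norm_num)))

theorem continuousOn_fderiv_gauge_apply (hL : ∀ x, x ≠ 0 → ContDiffAt ℝ 2 (gauge K) x)
    (v : EuclideanSpace ℝ (Fin n)) :
    ContinuousOn (fun z => fderiv ℝ (gauge K) z v) (indicatrix (gauge K)) := by
  intro z hz
  have hz1 : gauge K z = 1 := hz
  have hz0 : z ≠ 0 := by
    rintro rfl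
    rw [gauge_zero] at hz1
    exact zero_ne_one hz1
  exact (((hL z hz0).fderiv_right (m := 1) (by norm_num)).continuousAt.clm_apply
    continuousAt_const).continuousWithinAt

theorem continuousOn_one_sub_fderiv_gauge_rpow (hK : Convex ℝ K) (h0 : K ∈ 𝓝 0)
    (hL : ∀ x, x ≠ 0 → ContDiffAt ℝ 2 (gauge K) x)
    {p : EuclideanSpace ℝ (Fin n)} (hp : p ∈ interior K) (k : ℝ) :
    ContinuousOn (fun z => (1 - fderiv ℝ (gauge K) z p) ^ k) (indicatrix (gauge K)) := by
  refine ContinuousOn.rpow_const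
    (continuousOn_const.sub (continuousOn_fderiv_gauge_apply hL p)) fun z hz => Or.inl ?_
  have hz1 : gauge K z = 1 := hz
  have hz0 : z ≠ 0 := by
    rintro rfl
    rw [gauge_zero] at hz1
    exact zero_ne_one hz1
  have := fderiv_gauge_apply_lt_one hK h0 hp ((hL z hz0).differentiableAt (by norm_num))
  exact (sub_pos.2 this).ne'

theorem areaFunction_zero (hK : Convex ℝ K) (hb : Bornology.IsBounded K) (h0 : K ∈ 𝓝 0)
    (hL : ∀ x, x ≠ 0 → ContDiffAt ℝ 2 (gauge K) x) :
    areaFunction K 0 = indicatrixIntegral (gauge K) fun _ => 1 := by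
  rw [areaFunction_eq hK hb h0 hL (mem_interior_iff_mem_nhds.2 h0)]
  simp

/-- The graph of the area function lies above the affine function `r(0) + k β`, `k = (n - 1) / 2`. -/
theorem areaFunction_zero_add_le (hn : 1 ≤ n) (hK : Convex ℝ K) (hc : IsCompact K)
    (h0 : K ∈ 𝓝 0) (hL : ∀ x, x ≠ 0 → ContDiffAt ℝ 2 (gauge K) x)
    {p : EuclideanSpace ℝ (Fin n)} (hp : p ∈ interior K) :
    areaFunction K 0 + ((n : ℝ) - 1) / 2 * associatedForm (gauge K) p ≤ areaFunction K p := by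
  have hk : 0 ≤ ((n : ℝ) - 1) / 2 := by
    have : (1 : ℝ) ≤ n := by exact_mod_cast hn
    linarith
  have hf := continuousOn_fderiv_gauge_apply hL p
  have h1 := indicatrixIntegral_const_add_mul hn hK hc h0 hL hf 1 (((n : ℝ) - 1) / 2)
  rw [one_mul] at h1
  rw [areaFunction_zero hK hc.isBounded h0 hL, areaFunction_eq hK hc.isBounded h0 hL hp,
    associatedForm, ← h1]
  refine indicatrixIntegral_mono hn hK hc h0 hL
    (continuousOn_const.add (continuousOn_const.mul hf))
    (continuousOn_one_sub_fderiv_gauge_rpow hK h0 hL hp _) fun z hz0 _ => ?_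
  exact one_add_mul_le_one_sub_rpow_neg hk
    (fderiv_gauge_apply_lt_one hK h0 hp ((hL z hz0).differentiableAt (by norm_num)))

/-- The upper half of the first-order expansion of the area function at the origin along a ray. -/
theorem exists_areaFunction_smul_le (hn : 1 ≤ n) (hK : Convex ℝ K) (hc : IsCompact K)
    (h0 : K ∈ 𝓝 0) (hL : ∀ x, x ≠ 0 → ContDiffAt ℝ 2 (gauge K) x)
    (v : EuclideanSpace ℝ (Fin n)) :
    ∃ C δ : ℝ, 0 < δ ∧ ∀ t : ℝ, 0 < t → t ≤ δ → t • v ∈ interior K ∧ areaFunction K (t • v) ≤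
      areaFunction K 0 + t * (((n : ℝ) - 1) / 2 * associatedForm (gauge K) v) + C * t ^ 2 := by
  have hk : 0 ≤ ((n : ℝ) - 1) / 2 := by
    have : (1 : ℝ) ≤ n := by exact_mod_cast hn
    linarith
  set k : ℝ := ((n : ℝ) - 1) / 2 with hkdef
  have hom : ∀ t : ℝ, 0 ≤ t → ∀ x, gauge K (t • x) = t * gauge K x :=
    fun _ ht _ => gauge_smul_of_nonneg ht _
  obtain ⟨M, hM0, hM1, hM2⟩ : ∃ M, 0 ≤ M ∧ gauge K v ≤ M ∧ gauge K (-v) ≤ M :=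
    ⟨max (gauge K v) (gauge K (-v)), (gauge_nonneg v).trans (le_max_left _ _),
      le_max_left _ _, le_max_right _ _⟩
  have habs : ∀ z, z ≠ 0 → |fderiv ℝ (gauge K) z v| ≤ M := by
    intro z hz
    have hd : DifferentiableAt ℝ (gauge K) z := (hL z hz).differentiableAt (by norm_num)
    have sub := gauge_add_le hK (absorbent_nhds_zero h0)
    have h1 := fderiv_apply_le_of_sublinear hom sub hd v
    have h2 := fderiv_apply_le_of_sublinear hom sub hd (-v)
    rw [map_neg] at h2
    exact abs_le.2 ⟨by linarith, by linarith⟩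
  -- For `t` up to this bound, `s = t dL_z(v)` satisfies `|s| ≤ 1 / 2` and `2 k |s| ≤ 1`.
  refine ⟨(2 * k + 4 * k ^ 2) * M ^ 2 * areaFunction K 0, (2 * (1 + k) * (M + 1))⁻¹,
    by positivity, fun t ht htδ => ?_⟩
  have htM : 2 * (1 + k) * (t * M) ≤ 1 := by
    have h1 : t * (2 * (1 + k) * (M + 1)) ≤ 1 := by
      have h2 : 0 < 2 * (1 + k) * (M + 1) := by positivity
      exact (le_div_iff₀ h2).1 (by rwa [one_div])
    have h3 : 0 ≤ t * (2 * (1 + k)) := by positivity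
    nlinarith
  have htM0 : 0 ≤ t * M := by positivity
  have hktM : 0 ≤ k * (t * M) := by positivity
  have hmem : t • v ∈ interior K := by
    rw [← gauge_lt_one_iff_mem_interior hK h0, hom t ht.le]
    have := mul_le_mul_of_nonneg_left hM1 ht.le
    linarith
  refine ⟨hmem, ?_⟩
  have hf := continuousOn_fderiv_gauge_apply hL v
  have h1 := indicatrixIntegral_const_add_mul hn hK hc h0 hL hf
    (1 + (2 * k + 4 * k ^ 2) * (t * M) ^ 2) (k * t)
  have h2 : areaFunction K (t • v) ≤ indicatrixIntegral (gauge K) fun z =>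
      (1 + (2 * k + 4 * k ^ 2) * (t * M) ^ 2) + (k * t) * fderiv ℝ (gauge K) z v := by
    rw [areaFunction_eq hK hc.isBounded h0 hL hmem]
    refine indicatrixIntegral_mono hn hK hc h0 hL
      (continuousOn_one_sub_fderiv_gauge_rpow hK h0 hL hmem _)
      (continuousOn_const.add (continuousOn_const.mul hf)) fun z hz0 _ => ?_
    rw [map_smul, smul_eq_mul, ← hkdef]
    have h3 : |t * fderiv ℝ (gauge K) z v| ≤ t * M := by
      rw [abs_mul, abs_of_pos ht]
      exact mul_le_mul_of_nonneg_left (habs z hz0) ht.le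
    have h4 : (t * fderiv ℝ (gauge K) z v) ^ 2 ≤ (t * M) ^ 2 := by
      rw [← sq_abs]
      exact pow_le_pow_left₀ (abs_nonneg _) h3 2
    have h5 := mul_le_mul_of_nonneg_left h3 hk
    have h6 := one_sub_rpow_neg_le hk (s := t * fderiv ℝ (gauge K) z v)
      (by linarith) (by linarith)
    have h7 := mul_le_mul_of_nonneg_left h4 (show 0 ≤ 2 * k + 4 * k ^ 2 by positivity)
    linarith
  rw [h1, ← areaFunction_zero hK hc.isBounded h0 hL] at h2
  refine h2.trans (le_of_eq ?_)
  rw [associatedForm]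
  ring

theorem associatedForm_neg (L : EuclideanSpace ℝ (Fin n) → ℝ) (v : EuclideanSpace ℝ (Fin n)) :
    associatedForm L (-v) = -associatedForm L v := by
  simp [associatedForm, indicatrixIntegral, integral_neg]

end Body

/-! ### Balanced bodies -/

theorem corollary5 (n : ℕ) (hn : 2 ≤ n) (K : ConvexBody (EuclideanSpace ℝ (Fin n)))
    (h0 : (0 : EuclideanSpace ℝ (Fin n)) ∈ interior (K : Set (EuclideanSpace ℝ (Fin n))))
    (hL : IsFinslerMinkowski (gauge (K : Set (EuclideanSpace ℝ (Fin n))))) :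
    IsBalancedBody (K : Set (EuclideanSpace ℝ (Fin n))) ↔
      IsMinOn (areaFunction (K : Set (EuclideanSpace ℝ (Fin n))))
        (interior (K : Set (EuclideanSpace ℝ (Fin n)))) 0 := by
  have hn1 : 1 ≤ n := by omega
  have h0' : (K : Set (EuclideanSpace ℝ (Fin n))) ∈ 𝓝 0 := mem_interior_iff_mem_nhds.1 h0
  have hL2 : ∀ x, x ≠ 0 → ContDiffAt ℝ 2 (gauge (K : Set (EuclideanSpace ℝ (Fin n)))) x :=
    fun x hx => (hL x hx).1.of_le (by norm_num)
  rw [isMinOn_iff]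
  refine ⟨fun hbal p hp => ?_, fun hmin => ?_⟩
  · have h := areaFunction_zero_add_le hn1 K.convex K.isCompact h0' hL2 hp
    rwa [hbal p, mul_zero, add_zero] at h
  · have hk : 0 < ((n : ℝ) - 1) / 2 := by
      have : (2 : ℝ) ≤ n := by exact_mod_cast hn
      linarith
    have hnonneg : ∀ v, 0 ≤ associatedForm (gauge (K : Set (EuclideanSpace ℝ (Fin n)))) v := by
      intro v
      obtain ⟨C, δ, hδ, h⟩ := exists_areaFunction_smul_le hn1 K.convex K.isCompact h0' hL2 v
      refine nonneg_of_mul_nonneg_right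
        (nonneg_of_forall_small_quadratic_nonneg (C := C) hδ fun t ht htδ => ?_) hk
      obtain ⟨hmem, hle⟩ := h t ht htδ
      linarith [hmin _ hmem]
    intro v
    have h1 := hnonneg (-v)
    rw [associatedForm_neg] at h1
    exact le_antisymm (by linarith) (hnonneg v)
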